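/- Let $k$ be a field and let $\Lambda$ be a finite-dimensional $k$-algebra with Jacobson radical $\mathfrak r$ and enveloping algebra $\Lambda^{e}=\Lambda\otimes_k\Lambda^{\mathrm{op}}$. Suppose that $\Lambda$ is symmetric, that is, $\Lambda\cong\operatorname{Hom}_k(\Lambda,k)$ as $\Lambda$-$\Lambda$-bimodules; that $\Lambda$ is periodic, that is, there is an integer $p>0$ with $\Lambda\cong\Omega^{p}_{\Lambda^{e}}(\Lambda)$ as left $\Lambda^{e}$-modules (bimodules), where $\Omega^{p}_{\Lambda^{e}}(\Lambda)$ denotes the $p$-th syzygy in a minimal projective resolution of $\Lambda$ over $\Lambda^{e}$; and that the ring $\Lambda/\mathfrak r\otimes_k\Lambda/\mathfrak r$ is semisimple. Then for all finitely generated left $\Lambda$-modules $M$ and $N$ the following are equivalent: (i) $\operatorname{Ext}^i_\Lambda(M,N)=0$ for $i\gg 0$; (ii) $\operatorname{Ext}^i_\Lambda(M,N)=0$ for all $i>0$; (iii) $\operatorname{Ext}^i_\Lambda(N,M)=0$ for $i\gg 0$; (iv) $\operatorname{Ext}^i_\Lambda(N,M)=0$ for all $i>0$. -/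

import Mathlib

open CategoryTheory
open scoped TensorProduct

universe u v

/-- `f : P → M` is a projective cover: `P` is projective, `f` is onto, and the kernel of `f` is a
superfluous submodule of `P`. -/
structure IsProjectiveCover {R : Type u} [Ring R] {P M : Type v} [AddCommGroup P] [Module R P]
    [AddCommGroup M] [Module R M] (f : P →ₗ[R] M) : Prop where
  projective : Module.Projective R P
  surjective : Function.Surjective f
  superfluous : ∀ S : Submodule R P, S ⊔ LinearMap.ker f = ⊤ → S = ⊤

/-- `IsMinimalSyzygy n M X`: the module `X` is (isomorphic to) the `n`-th syzygy `Ω^n M`, computed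
from a minimal projective resolution of `M`, that is, by taking `n` times in succession the kernel
of a projective cover. -/
def IsMinimalSyzygy {R : Type u} [Ring R] : ℕ → ModuleCat.{v} R → ModuleCat.{v} R → Prop
  | 0, M, X => Nonempty (X ≅ M)
  | n + 1, M, X => ∃ (P : ModuleCat.{v} R) (f : P →ₗ[R] M), IsProjectiveCover f ∧
      IsMinimalSyzygy n (ModuleCat.of R (LinearMap.ker f)) X

/-- `Λ` as a left module over its enveloping algebra `Λ ⊗ Λᵒᵖ`, where
`(a ⊗ b) • x = a * x * b`. -/
def regularBimodule (k : Type u) (Λ : Type v) [Field k] [Ring Λ] [Algebra k Λ] :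
    ModuleCat.{v} (Λ ⊗[k] Λᵐᵒᵖ) :=
  letI : Module (Λ ⊗[k] Λᵐᵒᵖ) Λ := TensorProduct.Algebra.module
  ModuleCat.of (Λ ⊗[k] Λᵐᵒᵖ) Λ

/-- `Λ` is periodic: `Λ ≅ Ω^p(Λ)` as bimodules for some `p > 0`. -/
def IsPeriodicAlgebra (k : Type u) (Λ : Type v) [Field k] [Ring Λ] [Algebra k Λ] : Prop :=
  ∃ p : ℕ, 0 < p ∧ IsMinimalSyzygy p (regularBimodule k Λ) (regularBimodule k Λ)

/-- `Λ` is symmetric: `Λ ≅ Hom_k(Λ, k)` as bimodules, where `(a • φ • b) x = φ (b * x * a)`. -/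
def IsSymmAlgebra (k : Type u) (Λ : Type v) [Field k] [Ring Λ] [Algebra k Λ] : Prop :=
  ∃ e : Λ ≃ₗ[k] Module.Dual k Λ, ∀ a b y x : Λ, e (a * y * b) x = e y (b * x * a)

/-! Two mechanisms drive the proof: a loop of cosyzygies and a trace duality.

Loop. All bimodule syzygies of `Λ` are projective as left modules, so applying `Hom_Λ(-, N)` to a
minimal bimodule resolution keeps it exact. The symmetrizing form gives `Hom_Λ(Λ ⊗ Λᵐᵒᵖ, N) ≅
Hom_k(Λ, N) ≅ Λ^d` with `d = dim_k N`, so the terms become finitely generated projective left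
modules. The resulting sequence starts at `Hom_Λ(Λ, N) ≅ N` and by periodicity returns to `N`
(`IsPeriodicAlgebra.transGen_isCosyzygy`). Finitely generated projectives are also injective, so a
cosyzygy step in the second argument lowers the `Ext` degree by one. Going round the loop turns
eventual vanishing into vanishing in all positive degrees (`extVanishesFrom_one`).

Duality. For `Q` finitely generated projective, the trace pairing identifies `Hom(M, Q)` with the
`k`-dual of `Hom(Q, M)`, naturally in `Q`. Exactness therefore passes from one side to the other
(`exists_comp_eq_of_exact`), and `Ext^1(M, A) = 0` gives `Ext^1(D, M) = 0` for the third cosyzygy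
`D` of `A` (`subsingleton_ext_one`). Every module on the loop has a predecessor there, so this
reaches all positive degrees and exchanges the roles of `M` and `N` (`extVanishesFrom_one_symm`). -/

/-! ### Symmetrizing forms and self-injectivity -/

/-- A symmetrizing form on `Λ`: a nondegenerate trace form inducing `Λ ≃ Hom_k(Λ, k)`. -/
structure IsSymmetrizingForm {k : Type u} {Λ : Type v} [Field k] [Ring Λ] [Algebra k Λ]
    (t : Λ →ₗ[k] k) : Prop where
  mul_comm : ∀ a b, t (a * b) = t (b * a)
  nondegenerate : ∀ y, (∀ x, t (x * y) = 0) → y = 0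
  represents : ∀ φ : Λ →ₗ[k] k, ∃ y, ∀ x, t (x * y) = φ x

theorem IsSymmAlgebra.exists_symmetrizingForm {k : Type u} {Λ : Type v} [Field k] [Ring Λ]
    [Algebra k Λ] (h : IsSymmAlgebra k Λ) : ∃ t : Λ →ₗ[k] k, IsSymmetrizingForm t := by
  obtain ⟨e, he⟩ := h
  -- Moving `y` out of `e` by the left or by the right action gives two formulas; their agreement is
  -- the trace property of `e 1`.
  have hl : ∀ y x, e y x = e 1 (x * y) := fun y x => by simpa using he y 1 1 x
  have hr : ∀ y x, e y x = e 1 (y * x) := fun y x => by simpa using he 1 y 1 x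
  refine ⟨e 1, fun a b => by rw [← hl, hr], fun y hy => ?_, fun φ => ⟨e.symm φ, fun x => ?_⟩⟩
  · apply e.injective
    rw [map_zero]
    exact LinearMap.ext fun x => by rw [hl, hy, LinearMap.zero_apply]
  · rw [← hl, e.apply_symm_apply]

namespace IsSymmetrizingForm

variable {k : Type u} {Λ : Type v} [Field k] [Ring Λ] [Algebra k Λ] {t : Λ →ₗ[k] k}

theorem ext (ht : IsSymmetrizingForm t) {a b : Λ} (h : ∀ x, t (x * a) = t (x * b)) : a = b :=
  sub_eq_zero.1 <| ht.nondegenerate _ fun x => by rw [mul_sub, map_sub, h, sub_self]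

theorem linearMap_ext {X : Type*} [AddCommGroup X] [Module Λ X]
    (ht : IsSymmetrizingForm t) {f g : X →ₗ[Λ] Λ} (h : ∀ x, t (f x) = t (g x)) : f = g :=
  LinearMap.ext fun x => ht.ext fun a => by
    simpa only [map_smul, smul_eq_mul] using h (a • x)

section Functional

variable {X : Type*} [AddCommGroup X] [Module k X] [Module Λ X] [IsScalarTower k Λ X]

/-- Every linear functional on a `Λ`-module factors through the symmetrizing form. -/
theorem exists_linearMap (ht : IsSymmetrizingForm t) (φ : X →ₗ[k] k) :
    ∃ f : X →ₗ[Λ] Λ, ∀ x, t (f x) = φ x := by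
  -- `F x` represents `a ↦ φ (a • x)`; uniqueness of representatives makes `F` linear.
  choose F hF using fun x : X =>
    ht.represents (φ ∘ₗ (LinearMap.toSpanSingleton Λ X x).restrictScalars k)
  simp only [LinearMap.comp_apply, LinearMap.restrictScalars_apply,
    LinearMap.toSpanSingleton_apply] at hF
  refine ⟨⟨⟨F, fun x y => ht.ext fun a => ?_⟩, fun b x => ht.ext fun a => ?_⟩, fun x => ?_⟩
  · rw [mul_add, map_add, hF, hF, hF, smul_add, map_add]
  · rw [RingHom.id_apply, smul_eq_mul, ← mul_assoc, hF, hF, mul_smul]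
  · simpa using hF x 1

/-- Only the functional `t ∘ f` has to be extended, which a `k`-linear retraction of `i` does; the
form turns the result back into a `Λ`-linear map. -/
theorem exists_extension (ht : IsSymmetrizingForm t) {Y : Type*} [AddCommGroup Y] [Module k Y]
    [Module Λ Y] [IsScalarTower k Λ Y] (i : X →ₗ[Λ] Y) (hi : Function.Injective i)
    (f : X →ₗ[Λ] Λ) : ∃ g : Y →ₗ[Λ] Λ, g ∘ₗ i = f := by
  obtain ⟨r, hr⟩ := (i.restrictScalars k).exists_leftInverse_of_injective
    (LinearMap.ker_eq_bot.2 hi)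
  obtain ⟨g, hg⟩ := ht.exists_linearMap (t ∘ₗ f.restrictScalars k ∘ₗ r)
  refine ⟨g, ht.linearMap_ext fun x => ?_⟩
  have := LinearMap.congr_fun hr x
  simp only [LinearMap.comp_apply, LinearMap.restrictScalars_apply, LinearMap.id_apply] at this
  simp [hg, this]

end Functional

theorem injective_of_finite_projective (ht : IsSymmetrizingForm t) (Q : Type v) [AddCommGroup Q]
    [Module Λ Q] [Module.Finite Λ Q] [Module.Projective Λ Q] : Module.Injective Λ Q := by
  obtain ⟨n, r, s, -, -, hrs⟩ := Module.Finite.exists_comp_eq_id_of_projective Λ Q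
  refine ⟨fun X Y _ _ _ _ i hi f => ?_⟩
  let _ : Module k X := Module.compHom X (algebraMap k Λ)
  let _ : Module k Y := Module.compHom Y (algebraMap k Λ)
  have : IsScalarTower k Λ X := ⟨fun a b x => by rw [Algebra.smul_def, mul_smul]; rfl⟩
  have : IsScalarTower k Λ Y := ⟨fun a b x => by rw [Algebra.smul_def, mul_smul]; rfl⟩
  choose g hg using fun j => ht.exists_extension i hi (LinearMap.proj j ∘ₗ s ∘ₗ f)
  refine ⟨r ∘ₗ LinearMap.pi g, fun x => ?_⟩
  have : LinearMap.pi g (i x) = s (f x) := funext fun j => LinearMap.congr_fun (hg j) x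
  rw [LinearMap.comp_apply, this]
  exact LinearMap.congr_fun hrs (f x)

/-! ### Traces and the duality between `Hom(M, Q)` and `Hom(Q, M)` -/

theorem apply_eq_sum_single {X : Type*} [AddCommGroup X] [Module Λ X] {n : ℕ}
    (h : (Fin n → Λ) →ₗ[Λ] X) (x : Fin n → Λ) : h x = ∑ j, x j • h (Pi.single j 1) := by
  conv_lhs => rw [← Finset.univ_sum_single x, map_sum]
  refine Finset.sum_congr rfl fun j _ => ?_
  rw [← map_smul, ← Pi.single_smul, smul_eq_mul, mul_one]

/-- The trace of an endomorphism of `Λⁿ`, composed with the form `t`. -/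
def matrixTrace (t : Λ →ₗ[k] k) {n : ℕ} (f : (Fin n → Λ) →ₗ[Λ] (Fin n → Λ)) : k :=
  ∑ i, t (f (Pi.single i 1) i)

theorem matrixTrace_comp_comm (ht : IsSymmetrizingForm t) {m n : ℕ}
    (f : (Fin m → Λ) →ₗ[Λ] (Fin n → Λ)) (g : (Fin n → Λ) →ₗ[Λ] (Fin m → Λ)) :
    matrixTrace t (g ∘ₗ f) = matrixTrace t (f ∘ₗ g) := by
  have expand : ∀ {a b : ℕ} (h : (Fin a → Λ) →ₗ[Λ] (Fin b → Λ)) (x : Fin a → Λ) (i : Fin b),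
      h x i = ∑ j, x j * h (Pi.single j 1) i := by
    intro a b h x i
    rw [apply_eq_sum_single h x, Finset.sum_apply]
    rfl
  simp only [matrixTrace, LinearMap.comp_apply]
  -- Both sides become double sums over products of matrix entries, differing only in the order of
  -- the factors inside `t`.
  simp only [expand g (f _), expand f (g _), map_sum]
  rw [Finset.sum_comm]
  exact Finset.sum_congr rfl fun i _ => Finset.sum_congr rfl fun j _ => ht.mul_comm _ _

/-- Presentation of a finitely generated projective module as a direct summand of `Λⁿ`. -/
structure FreeRetract (Λ : Type v) [Ring Λ] (Q : Type*) [AddCommGroup Q] [Module Λ Q] where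
  /-- the rank of the free module -/
  n : ℕ
  /-- the projection -/
  r : (Fin n → Λ) →ₗ[Λ] Q
  /-- the inclusion -/
  s : Q →ₗ[Λ] (Fin n → Λ)
  r_comp_s : r ∘ₗ s = LinearMap.id

theorem FreeRetract.r_s {Q : Type*} [AddCommGroup Q] [Module Λ Q] (E : FreeRetract Λ Q) (x : Q) :
    E.r (E.s x) = x :=
  LinearMap.congr_fun E.r_comp_s x

theorem FreeRetract.nonempty (Q : Type*) [AddCommGroup Q] [Module Λ Q] [Module.Finite Λ Q]
    [Module.Projective Λ Q] : Nonempty (FreeRetract Λ Q) := by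
  obtain ⟨n, r, s, -, -, hrs⟩ := Module.Finite.exists_comp_eq_id_of_projective Λ Q
  exact ⟨⟨n, r, s, hrs⟩⟩

section Pairing

variable {M Q Q' : Type*} [AddCommGroup M] [Module Λ M] [AddCommGroup Q] [Module Λ Q]
  [AddCommGroup Q'] [Module Λ Q']

/-- The trace pairing between `Hom(M, Q)` and `Hom(Q, M)`. -/
def tracePairing (t : Λ →ₗ[k] k) (E : FreeRetract Λ Q) (g : M →ₗ[Λ] Q) (f : Q →ₗ[Λ] M) : k :=
  matrixTrace t (E.s ∘ₗ g ∘ₗ f ∘ₗ E.r)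

/-- Naturality in `Q`, from cyclicity of the trace. It also shows that the choice of retract is
immaterial (take `h` the identity). -/
theorem tracePairing_comp (ht : IsSymmetrizingForm t) (E : FreeRetract Λ Q)
    (E' : FreeRetract Λ Q') (h : Q →ₗ[Λ] Q') (g : M →ₗ[Λ] Q) (f : Q' →ₗ[Λ] M) :
    tracePairing t E' (h ∘ₗ g) f = tracePairing t E g (f ∘ₗ h) := by
  have h1 : E'.s ∘ₗ (h ∘ₗ g) ∘ₗ f ∘ₗ E'.r =
      (E'.s ∘ₗ h ∘ₗ E.r) ∘ₗ (E.s ∘ₗ g ∘ₗ f ∘ₗ E'.r) := by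
    refine LinearMap.ext fun x => ?_
    simp [E.r_s]
  have h2 : E.s ∘ₗ g ∘ₗ (f ∘ₗ h) ∘ₗ E.r =
      (E.s ∘ₗ g ∘ₗ f ∘ₗ E'.r) ∘ₗ (E'.s ∘ₗ h ∘ₗ E.r) := by
    refine LinearMap.ext fun x => ?_
    simp [E'.r_s]
  rw [tracePairing, tracePairing, h1, h2, ht.matrixTrace_comp_comm]

/-- Rank-one maps read off the coordinates of `g`; they are the test maps for nondegeneracy and for
representability of functionals. Naturality reduces the computation to a free module. -/
theorem tracePairing_smulRight (ht : IsSymmetrizingForm t) (E : FreeRetract Λ Q)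
    (g : M →ₗ[Λ] Q) (i : Fin E.n) (x : M) :
    tracePairing t E g ((LinearMap.proj i ∘ₗ E.s).smulRight x) = t (E.s (g x) i) := by
  let F : FreeRetract Λ (Fin E.n → Λ) := ⟨E.n, LinearMap.id, LinearMap.id, rfl⟩
  have h : (LinearMap.proj i ∘ₗ E.s).smulRight x =
      (LinearMap.proj (φ := fun _ => Λ) i).smulRight x ∘ₗ E.s := rfl
  rw [h, ← ht.tracePairing_comp E F]
  simp only [tracePairing, matrixTrace]
  rw [Finset.sum_eq_single i]
  · simp [F]
  · intro j _ hj
    simp [F, hj.symm]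
  · simp

theorem eq_zero_of_tracePairing (ht : IsSymmetrizingForm t) (E : FreeRetract Λ Q)
    (g : M →ₗ[Λ] Q) (h : ∀ f, tracePairing t E g f = 0) : g = 0 := by
  have hs : ∀ x, E.s (g x) = 0 := fun x => funext fun i => ht.nondegenerate _ fun a => by
    have := h ((LinearMap.proj i ∘ₗ E.s).smulRight (a • x))
    rw [ht.tracePairing_smulRight] at this
    simpa using this
  exact LinearMap.ext fun x => by rw [← E.r_s (g x), hs, map_zero, LinearMap.zero_apply]

/-- Every linear functional on `Hom(Q, M)` is given by the trace pairing. -/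
theorem exists_tracePairing_eq (ht : IsSymmetrizingForm t) [Module k M] [IsScalarTower k Λ M]
    (E : FreeRetract Λ Q) (ξ : (Q →ₗ[Λ] M) →ₗ[k] k) :
    ∃ g : M →ₗ[Λ] Q, ∀ f, tracePairing t E g f = ξ f := by
  have hlin : ∀ i : Fin E.n, ∃ φ : M →ₗ[k] k,
      ∀ x, φ x = ξ ((LinearMap.proj i ∘ₗ E.s).smulRight x) := fun i =>
    ⟨⟨⟨fun x => ξ ((LinearMap.proj i ∘ₗ E.s).smulRight x), fun x y => by
      rw [← map_add]; congr 1; exact LinearMap.ext fun z => by simp⟩, fun c x => by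
      rw [RingHom.id_apply, ← map_smul]; refine congrArg ξ ?_
      exact LinearMap.ext fun z => by simp [smul_comm _ c x]⟩, fun x => rfl⟩
  choose φ hφ using hlin
  choose g0 hg0 using fun i => ht.exists_linearMap (φ i)
  let F : FreeRetract Λ (Fin E.n → Λ) := ⟨E.n, LinearMap.id, LinearMap.id, rfl⟩
  refine ⟨E.r ∘ₗ LinearMap.pi g0, fun f => ?_⟩
  rw [ht.tracePairing_comp F E]
  -- Since `x = r (s x)`, every `f` is a sum of rank-one maps, so `ξ` is determined by the `φ i`.
  have hf : f = ∑ i, (LinearMap.proj i ∘ₗ E.s).smulRight (f (E.r (Pi.single i 1))) := by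
    ext x
    conv_lhs => rw [← E.r_s x, ← LinearMap.comp_apply, apply_eq_sum_single (f ∘ₗ E.r) (E.s x)]
    simp
  conv_rhs => rw [hf, map_sum]
  simp only [tracePairing, matrixTrace]
  refine Finset.sum_congr rfl fun i _ => ?_
  simp [F, hg0, hφ]

/-- Exactness of `Hom(M, Q₀) → Hom(M, Q₁) → Hom(M, Q₂)` is inherited by
`Hom(Q₂, M) → Hom(Q₁, M) → Hom(Q₀, M)`. -/
theorem exists_comp_eq_of_exact (ht : IsSymmetrizingForm t) {Q₀ Q₁ Q₂ : Type*}
    [AddCommGroup Q₀] [Module Λ Q₀] [Module.Finite Λ Q₀] [Module.Projective Λ Q₀]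
    [AddCommGroup Q₁] [Module Λ Q₁] [Module.Finite Λ Q₁] [Module.Projective Λ Q₁]
    [AddCommGroup Q₂] [Module Λ Q₂] [Module.Finite Λ Q₂] [Module.Projective Λ Q₂]
    (d : Q₀ →ₗ[Λ] Q₁) (d' : Q₁ →ₗ[Λ] Q₂)
    (hex : ∀ g : M →ₗ[Λ] Q₁, d' ∘ₗ g = 0 → ∃ g₀ : M →ₗ[Λ] Q₀, d ∘ₗ g₀ = g)
    (f : Q₁ →ₗ[Λ] M) (hf : f ∘ₗ d = 0) : ∃ f' : Q₂ →ₗ[Λ] M, f' ∘ₗ d' = f := by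
  let _ : Module k M := Module.compHom M (algebraMap k Λ)
  have : IsScalarTower k Λ M := ⟨fun a b x => by rw [Algebra.smul_def, mul_smul]; rfl⟩
  obtain ⟨E₀⟩ := FreeRetract.nonempty (Λ := Λ) Q₀
  obtain ⟨E₁⟩ := FreeRetract.nonempty (Λ := Λ) Q₁
  obtain ⟨E₂⟩ := FreeRetract.nonempty (Λ := Λ) Q₂
  let D : (Q₂ →ₗ[Λ] M) →ₗ[k] (Q₁ →ₗ[Λ] M) :=
    { toFun := fun f' => f' ∘ₗ d'
      map_add' := fun _ _ => rfl
      map_smul' := fun _ _ => rfl }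
  by_contra hne
  have hmem : f ∉ LinearMap.range D := fun ⟨f', hf'⟩ => hne ⟨f', hf'⟩
  -- A functional separating `f` from the range is pairing with some `g`. Vanishing on the range
  -- means `d' ∘ₗ g = 0`, so `g` lifts through `d`, and then `f ∘ₗ d = 0` forces `ξ f = 0`.
  obtain ⟨ξ, hξ, hle⟩ := Submodule.exists_le_ker_of_notMem hmem
  obtain ⟨g, hg⟩ := ht.exists_tracePairing_eq E₁ ξ
  have hg0 : d' ∘ₗ g = 0 := ht.eq_zero_of_tracePairing E₂ _ fun f' => by
    rw [ht.tracePairing_comp E₁ E₂, hg]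
    exact hle ⟨f', rfl⟩
  obtain ⟨g₀, rfl⟩ := hex g hg0
  apply hξ
  rw [← hg, ht.tracePairing_comp E₀ E₁, hf]
  simp [tracePairing, matrixTrace]

end Pairing

end IsSymmetrizingForm

/-! ### Cosyzygies and dimension shifting -/

section Cosyzygy

variable {Λ : Type v} [Ring Λ]

/-- `Y` is a cosyzygy of `X`: there is a short exact sequence `0 → X → Q → Y → 0` with `Q` finitely
generated projective. -/
def IsCosyzygy (X Y : ModuleCat.{v} Λ) : Prop :=
  ∃ (Q : ModuleCat.{v} Λ) (i : X ⟶ Q) (q : Q ⟶ Y) (w : i ≫ q = 0),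
    Module.Finite Λ Q ∧ Module.Projective Λ Q ∧ (ShortComplex.mk i q w).ShortExact

theorem IsCosyzygy.of_exact {X Q Y : Type v} [AddCommGroup X] [Module Λ X] [AddCommGroup Q]
    [Module Λ Q] [AddCommGroup Y] [Module Λ Y] [Module.Finite Λ Q] [Module.Projective Λ Q]
    (i : X →ₗ[Λ] Q) (q : Q →ₗ[Λ] Y) (hi : Function.Injective i) (hex : Function.Exact i q)
    (hq : Function.Surjective q) : IsCosyzygy (ModuleCat.of Λ X) (ModuleCat.of Λ Y) :=
  ⟨ModuleCat.of Λ Q, ModuleCat.ofHom i, ModuleCat.ofHom q,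
    ModuleCat.hom_ext hex.linearMap_comp_eq_zero, ‹_›, ‹_›,
    ModuleCat.shortComplex_shortExact _ hex hi hq⟩

theorem IsCosyzygy.congr_right {X Y Y' : ModuleCat.{v} Λ} (h : IsCosyzygy X Y) (e : Y ≅ Y') :
    IsCosyzygy X Y' := by
  obtain ⟨Q, i, q, w, hf, hp, hS⟩ := h
  refine ⟨Q, i, q ≫ e.hom, by rw [← Category.assoc, w, Limits.zero_comp], hf, hp, ?_⟩
  exact ShortComplex.shortExact_of_iso (S₁ := .mk i q w)
    (ShortComplex.isoMk (Iso.refl _) (Iso.refl _) e (by simp) (by simp)) hS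

theorem IsCosyzygy.congr_left {X X' Y : ModuleCat.{v} Λ} (h : IsCosyzygy X Y) (e : X ≅ X') :
    IsCosyzygy X' Y := by
  obtain ⟨Q, i, q, w, hf, hp, hS⟩ := h
  refine ⟨Q, e.inv ≫ i, q, by rw [Category.assoc, w, Limits.comp_zero], hf, hp, ?_⟩
  exact ShortComplex.shortExact_of_iso (S₁ := .mk i q w)
    (ShortComplex.isoMk e (Iso.refl _) (Iso.refl _) (by simp) (by simp)) hS

/-- Vanishing of `Ext^j(M, X)` for `j ≥ n`. -/
def ExtVanishesFrom (n : ℕ) (M X : ModuleCat.{v} Λ) : Prop :=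
  ∀ j, n ≤ j → Subsingleton (Abelian.Ext M X j)

theorem subsingleton_ext_succ_of_isCosyzygy {X Y : ModuleCat.{v} Λ} (h : IsCosyzygy X Y)
    (M : ModuleCat.{v} Λ) {j : ℕ} (hX : Subsingleton (Abelian.Ext X M j)) :
    Subsingleton (Abelian.Ext Y M (j + 1)) := by
  obtain ⟨Q, i, q, w, hf, hp, hS⟩ := h
  refine subsingleton_of_forall_eq 0 fun x => ?_
  have : Projective (ShortComplex.mk i q w).X₂ :=
    inferInstanceAs (Projective Q)
  obtain ⟨y, rfl⟩ := precomp_extClass_surjective_of_projective_X₂ M hS j x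
  rw [@Subsingleton.elim _ hX y 0, map_zero]

end Cosyzygy

/-! ### Vanishing of `Ext` around a loop of cosyzygies -/

section Symmetric

variable {k : Type u} {Λ : Type v} [Field k] [Ring Λ] [Algebra k Λ] {t : Λ →ₗ[k] k}

/-- The middle term is injective, so `Ext^j(M, Q) = 0`; this needs `1 ≤ j`, since `Hom(M, Q)` need
not vanish. -/
theorem IsSymmetrizingForm.subsingleton_ext_of_isCosyzygy (ht : IsSymmetrizingForm t)
    {X Y : ModuleCat.{v} Λ} (h : IsCosyzygy X Y) (M : ModuleCat.{v} Λ) {j : ℕ} (hj : 1 ≤ j)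
    (hX : Subsingleton (Abelian.Ext M X (j + 1))) : Subsingleton (Abelian.Ext M Y j) := by
  obtain ⟨Q, i, q, w, hf, hp, hS⟩ := h
  refine subsingleton_of_forall_eq 0 fun x => ?_
  have := ht.injective_of_finite_projective Q
  have : Injective Q := Module.injective_object_of_injective_module (R := Λ) (M := Q)
  obtain ⟨j, rfl⟩ := Nat.exists_eq_add_of_le' hj
  obtain ⟨y, rfl⟩ := Abelian.Ext.covariant_sequence_exact₃ M hS x rfl
    (@Subsingleton.elim _ hX _ _)
  rw [show y = 0 from Abelian.Ext.eq_zero_of_injective (I := Q) y, Abelian.Ext.zero_comp]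

theorem IsSymmetrizingForm.extVanishesFrom_of_isCosyzygy (ht : IsSymmetrizingForm t)
    {X Y M : ModuleCat.{v} Λ} (h : IsCosyzygy X Y) {n : ℕ} (hn : 1 ≤ n)
    (hX : ExtVanishesFrom (n + 1) M X) : ExtVanishesFrom n M Y := fun j hj =>
  ht.subsingleton_ext_of_isCosyzygy h M (hn.trans hj) (hX _ (by omega))

theorem IsSymmetrizingForm.extVanishesFrom_of_transGen (ht : IsSymmetrizingForm t)
    {X Y M : ModuleCat.{v} Λ} (h : Relation.TransGen IsCosyzygy X Y) {n : ℕ} (hn : 1 ≤ n)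
    (hX : ExtVanishesFrom (n + 1) M X) : ExtVanishesFrom n M Y := by
  induction h with
  | single h => exact ht.extVanishesFrom_of_isCosyzygy h hn hX
  | tail _ h ih =>
    exact ht.extVanishesFrom_of_isCosyzygy h hn fun j hj => ih j (by omega)

/-- For a module occurring in its own sequence of cosyzygies, eventual vanishing of
`Ext^i(M, N)` is vanishing in all positive degrees. -/
theorem IsSymmetrizingForm.extVanishesFrom_one (ht : IsSymmetrizingForm t)
    {M N : ModuleCat.{v} Λ} (h : Relation.TransGen IsCosyzygy N N) {n : ℕ}
    (hN : ExtVanishesFrom n M N) : ExtVanishesFrom 1 M N := by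
  induction n with
  | zero => exact fun j _ => hN j (Nat.zero_le _)
  | succ n ih =>
    rcases Nat.eq_zero_or_pos n with rfl | hn
    · exact hN
    -- One turn around the loop lowers the bound by one.
    · exact ih (ht.extVanishesFrom_of_transGen h hn hN)

/-- Vanishing of `Ext^1(M, A)` forces vanishing of `Ext^1(D, M)` for the third cosyzygy `D`
of `A`. -/
theorem IsSymmetrizingForm.subsingleton_ext_one (ht : IsSymmetrizingForm t)
    {M A B C D : ModuleCat.{v} Λ} (hAB : IsCosyzygy A B) (hBC : IsCosyzygy B C)
    (hCD : IsCosyzygy C D) (hA : Subsingleton (Abelian.Ext M A 1)) :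
    Subsingleton (Abelian.Ext D M 1) := by
  obtain ⟨Q₀, i₀, q₀, w₀, hf₀, hp₀, hS₀⟩ := hAB
  obtain ⟨Q₁, i₁, q₁, w₁, hf₁, hp₁, hS₁⟩ := hBC
  obtain ⟨Q₂, i₂, q₂, w₂, hf₂, hp₂, hS₂⟩ := hCD
  refine subsingleton_of_forall_eq 0 fun x => ?_
  have : Projective (ShortComplex.mk i₂ q₂ w₂).X₂ := inferInstanceAs (Projective Q₂)
  -- The class comes from a map `φ : C ⟶ M`, and is zero once `φ` extends along `i₂`.
  obtain ⟨y, rfl⟩ := precomp_extClass_surjective_of_projective_X₂ M hS₂ 0 x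
  obtain ⟨φ, rfl⟩ := (Abelian.Ext.mk₀_bijective C M).2 y
  have hmono₂ : Mono i₂ := hS₂.mono_f
  have hepi₁ : Epi q₁ := hS₁.epi_g
  have hmono₁ : Mono (ShortComplex.mk i₁ q₁ w₁).f := hS₁.mono_f
  -- A map killed in `Q₂` lands in `B`, and the obstruction to lifting it to `Q₀` lies in `Ext^1(M,
  -- A) = 0`.
  have hlift : ∀ g : M ⟶ Q₁, g ≫ q₁ ≫ i₂ = 0 → ∃ g₀ : M ⟶ Q₀, g₀ ≫ q₀ ≫ i₁ = g := by
    intro g hg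
    have hg' : g ≫ q₁ = 0 := by
      rw [← cancel_mono i₂, Category.assoc, hg, Limits.zero_comp]
    obtain ⟨y, hy⟩ := Abelian.Ext.covariant_sequence_exact₃ M hS₀
      (Abelian.Ext.mk₀ (hS₁.exact.lift g hg')) (zero_add 1) (@Subsingleton.elim _ hA _ _)
    obtain ⟨g₀, rfl⟩ := (Abelian.Ext.mk₀_bijective M Q₀).2 y
    rw [Abelian.Ext.mk₀_comp_mk₀] at hy
    have hy' : g₀ ≫ q₀ = hS₁.exact.lift g hg' := (Abelian.Ext.mk₀_bijective M B).1 hy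
    exact ⟨g₀, by rw [← Category.assoc, hy']; exact hS₁.exact.lift_f g hg'⟩
  -- The duality extends `q₁ ≫ φ`, which vanishes on `Q₀`; cancelling the epimorphism `q₁` leaves an
  -- extension of `φ`.
  obtain ⟨ψ, hψ⟩ : ∃ ψ : Q₂ ⟶ M, i₂ ≫ ψ = φ := by
    obtain ⟨ψ, hψ⟩ := ht.exists_comp_eq_of_exact (M := M) (q₀ ≫ i₁).hom (q₁ ≫ i₂).hom
      (fun g hg => by
        obtain ⟨g₀, h₀⟩ := hlift (ModuleCat.ofHom g) (ModuleCat.hom_ext hg)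
        exact ⟨g₀.hom, congrArg ModuleCat.Hom.hom h₀⟩)
      (q₁ ≫ φ).hom (congrArg ModuleCat.Hom.hom
        (show (q₀ ≫ i₁) ≫ q₁ ≫ φ = 0 by
          rw [Category.assoc, ← Category.assoc i₁, w₁, Limits.zero_comp, Limits.comp_zero]))
    refine ⟨ModuleCat.ofHom ψ, ?_⟩
    rw [← cancel_epi q₁, ← Category.assoc]
    exact ModuleCat.hom_ext hψ
  rw [← hψ, ← Abelian.Ext.mk₀_comp_mk₀]
  exact hS₂.extClass_comp_assoc (n := 0) (n' := 0 + 1) (h := add_comm 1 0) (Abelian.Ext.mk₀ ψ)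

/-- Degree one is proved for every module on the loop at once, by going back three steps. Each
higher degree then follows by going back one more step, now shifting in the first argument. -/
theorem IsSymmetrizingForm.extVanishesFrom_one_symm (ht : IsSymmetrizingForm t)
    {M N : ModuleCat.{v} Λ} (h : Relation.TransGen IsCosyzygy N N)
    (hN : ExtVanishesFrom 1 M N) : ExtVanishesFrom 1 N M := by
  let Z : ModuleCat.{v} Λ → Prop := fun X =>
    Relation.TransGen IsCosyzygy N X ∧ Relation.TransGen IsCosyzygy X N
  have hpred : ∀ Y, Z Y → ∃ X, Z X ∧ IsCosyzygy X Y := by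
    rintro Y ⟨h1, h2⟩
    obtain ⟨X, h3, h4⟩ := Relation.TransGen.tail'_iff.1 h1
    rcases Relation.reflTransGen_iff_eq_or_transGen.1 h3 with rfl | h3
    · exact ⟨_, ⟨h, h⟩, h4⟩
    · exact ⟨X, ⟨h3, h2.head h4⟩, h4⟩
  have key : ∀ j Y, Z Y → Subsingleton (Abelian.Ext Y M (j + 1)) := by
    intro j
    induction j with
    | zero =>
      intro D hD
      obtain ⟨C, hC, hCD⟩ := hpred D hD
      obtain ⟨B, hB, hBC⟩ := hpred C hC
      obtain ⟨A, hA, hAB⟩ := hpred B hB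
      exact ht.subsingleton_ext_one hAB hBC hCD
        (ht.extVanishesFrom_of_transGen hA.1 le_rfl (fun j hj => hN j (by omega)) 1 le_rfl)
    | succ j ih =>
      intro Y hY
      obtain ⟨X, hX, hXY⟩ := hpred Y hY
      exact subsingleton_ext_succ_of_isCosyzygy hXY M (ih X hX)
  intro j hj
  obtain ⟨j, rfl⟩ := Nat.exists_eq_add_of_le' hj
  exact key j N ⟨h, h⟩

end Symmetric

/-! ### Left projective bimodules and `Hom_Λ(-, N)` -/

section Bimodule

variable (k : Type u) (Λ : Type v) [Field k] [Ring Λ] [Algebra k Λ]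

/-- A bimodule is left projective if it is projective as a left `Λ`-module. -/
def IsLeftProjective (L : Type*) [AddCommGroup L] [Module (Λ ⊗[k] Λᵐᵒᵖ) L] : Prop :=
  @Module.Projective Λ _ L _
    (Module.compHom L (Algebra.TensorProduct.includeLeftRingHom : Λ →+* Λ ⊗[k] Λᵐᵒᵖ))

/-- Homomorphisms of left `Λ`-modules from a bimodule to a left module. -/
def BimoduleHom (P N : Type*) [AddCommGroup P] [Module (Λ ⊗[k] Λᵐᵒᵖ) P] [AddCommGroup N]
    [Module Λ N] : AddSubgroup (P →+ N) where
  carrier := {f | ∀ (a : Λ) (x : P), f ((a ⊗ₜ[k] (1 : Λᵐᵒᵖ)) • x) = a • f x}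
  zero_mem' := fun a x => by simp
  add_mem' := fun hf hg a x => by
    rw [AddMonoidHom.add_apply, AddMonoidHom.add_apply, hf, hg, smul_add]
  neg_mem' := fun hf a x => by
    rw [AddMonoidHom.neg_apply, AddMonoidHom.neg_apply, hf, smul_neg]

namespace BimoduleHom

variable {k Λ} {P P' N : Type*} [AddCommGroup P] [Module (Λ ⊗[k] Λᵐᵒᵖ) P] [AddCommGroup P']
  [Module (Λ ⊗[k] Λᵐᵒᵖ) P'] [AddCommGroup N] [Module Λ N]

theorem map_left (f : BimoduleHom k Λ P N) (a : Λ) (x : P) :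
    f.1 ((a ⊗ₜ[k] (1 : Λᵐᵒᵖ)) • x) = a • f.1 x :=
  f.2 a x

/-- `Λ` acts on homomorphisms through the right action on the source. -/
instance : SMul Λ (BimoduleHom k Λ P N) where
  smul b f := ⟨f.1.comp (DistribSMul.toAddMonoidHom P ((1 : Λ) ⊗ₜ[k] MulOpposite.op b)),
    fun a x => by
      simp only [AddMonoidHom.comp_apply, DistribSMul.toAddMonoidHom_apply]
      rw [← map_left, smul_smul, smul_smul]
      simp⟩

theorem smul_apply (b : Λ) (f : BimoduleHom k Λ P N) (x : P) :
    (b • f).1 x = f.1 (((1 : Λ) ⊗ₜ[k] MulOpposite.op b) • x) := rfl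

@[ext]
theorem ext {f g : BimoduleHom k Λ P N} (h : ∀ x, f.1 x = g.1 x) : f = g :=
  Subtype.ext (AddMonoidHom.ext h)

theorem add_apply (f g : BimoduleHom k Λ P N) (x : P) : (f + g).1 x = f.1 x + g.1 x := rfl

instance : Module Λ (BimoduleHom k Λ P N) where
  one_smul f := ext fun x => by
    rw [smul_apply, MulOpposite.op_one, ← Algebra.TensorProduct.one_def, one_smul]
  mul_smul a b f := ext fun x => by
    rw [smul_apply, smul_apply, smul_apply, smul_smul]
    simp
  smul_zero a := rfl
  smul_add a f g := rfl
  add_smul a b f := ext fun x => by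
    rw [add_apply, smul_apply, smul_apply, smul_apply, ← map_add, ← add_smul,
      ← TensorProduct.tmul_add, MulOpposite.op_add]
  zero_smul f := ext fun x => by
    rw [smul_apply, MulOpposite.op_zero, TensorProduct.tmul_zero]
    exact (congrArg f.1 (zero_smul (Λ ⊗[k] Λᵐᵒᵖ) x)).trans (map_zero _)

variable (N) in
/-- Precomposition with a homomorphism of bimodules. -/
def precomp (g : P →ₗ[Λ ⊗[k] Λᵐᵒᵖ] P') : BimoduleHom k Λ P' N →ₗ[Λ] BimoduleHom k Λ P N where
  toFun f := ⟨f.1.comp g.toAddMonoidHom, fun a x => by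
    simp only [AddMonoidHom.comp_apply, LinearMap.toAddMonoidHom_coe, map_smul]
    rw [map_left]⟩
  map_add' _ _ := rfl
  map_smul' b f := ext fun x => by
    exact (congrArg f.1 (map_smul g ((1 : Λ) ⊗ₜ[k] MulOpposite.op b) x)).symm

theorem precomp_apply (g : P →ₗ[Λ ⊗[k] Λᵐᵒᵖ] P') (f : BimoduleHom k Λ P' N) (x : P) :
    (precomp N g f).1 x = f.1 (g x) := rfl

theorem precomp_injective (g : P →ₗ[Λ ⊗[k] Λᵐᵒᵖ] P') (hg : Function.Surjective g) :
    Function.Injective (precomp N g) := fun f f' h => ext fun y => by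
  obtain ⟨x, rfl⟩ := hg y
  exact congrArg (fun φ : BimoduleHom k Λ P N => φ.1 x) h

theorem precomp_exact (g : P →ₗ[Λ ⊗[k] Λᵐᵒᵖ] P') (hg : Function.Surjective g) :
    Function.Exact (precomp N g) (precomp (P := LinearMap.ker g) N (LinearMap.ker g).subtype) := by
  intro f
  constructor
  · intro hf
    have hker : ∀ x, g x = 0 → f.1 x = 0 := fun x hx =>
      congrArg (fun φ : BimoduleHom k Λ (LinearMap.ker g) N => φ.1 ⟨x, hx⟩) hf
    have hcongr : ∀ x y, g x = g y → f.1 x = f.1 y := fun x y hxy => by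
      rw [← sub_eq_zero, ← map_sub]
      exact hker _ (by rw [map_sub, hxy, sub_self])
    -- A set-theoretic section suffices: `f` is constant on the fibres of `g`, so `f ∘ σ` is linear
    -- although `σ` need not be.
    choose σ hσ using hg
    refine ⟨⟨⟨⟨fun y => f.1 (σ y), ?_⟩, fun y z => ?_⟩, fun a y => ?_⟩, ext fun x => ?_⟩
    · exact hker _ (hσ 0)
    · change f.1 _ = f.1 _ + f.1 _
      rw [← map_add]
      exact hcongr _ _ (by rw [hσ, map_add, hσ, hσ])
    · change f.1 _ = a • f.1 _
      rw [← map_left]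
      exact hcongr _ _ (by rw [hσ, map_smul, hσ])
    · exact hcongr _ _ (hσ _)
  · rintro ⟨f, rfl⟩
    refine ext fun x => ?_
    rw [precomp_apply, precomp_apply]
    exact (congrArg f.1 x.2).trans (map_zero _)

end BimoduleHom

namespace IsLeftProjective

variable {k Λ} {P L : Type*} [AddCommGroup P] [Module (Λ ⊗[k] Λᵐᵒᵖ) P] [AddCommGroup L]
  [Module (Λ ⊗[k] Λᵐᵒᵖ) L]

theorem exists_section (hL : IsLeftProjective k Λ L) (f : P →ₗ[Λ ⊗[k] Λᵐᵒᵖ] L)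
    (hf : Function.Surjective f) : ∃ s : L →+ P, (∀ x, f (s x) = x) ∧
      ∀ (a : Λ) (x : L), s ((a ⊗ₜ[k] (1 : Λᵐᵒᵖ)) • x) = (a ⊗ₜ[k] (1 : Λᵐᵒᵖ)) • s x := by
  let ι : Λ →+* Λ ⊗[k] Λᵐᵒᵖ := Algebra.TensorProduct.includeLeftRingHom
  let _ : Module Λ P := Module.compHom P ι
  let _ : Module Λ L := Module.compHom L ι
  have : Module.Projective Λ L := hL
  let f' : P →ₗ[Λ] L := ⟨f.toAddHom, fun a x => map_smul f (ι a) x⟩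
  obtain ⟨s, hs⟩ := Module.projective_lifting_property f' LinearMap.id hf
  exact ⟨s.toAddMonoidHom, fun x => LinearMap.congr_fun hs x, fun a x => map_smul s a x⟩

/-- A left linear section splits off the kernel. -/
theorem exists_retraction (hL : IsLeftProjective k Λ L) (f : P →ₗ[Λ ⊗[k] Λᵐᵒᵖ] L)
    (hf : Function.Surjective f) : ∃ r : P →+ LinearMap.ker f,
      (∀ x : LinearMap.ker f, r x = x) ∧
      ∀ (a : Λ) (x : P), r ((a ⊗ₜ[k] (1 : Λᵐᵒᵖ)) • x) = (a ⊗ₜ[k] (1 : Λᵐᵒᵖ)) • r x := by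
  obtain ⟨s, hs, hlin⟩ := hL.exists_section f hf
  refine ⟨⟨⟨fun x => ⟨x - s (f x), by simp [hs]⟩, by simp⟩, fun x y => ?_⟩, fun x => ?_,
    fun a x => ?_⟩
  · ext
    simp only [map_add, Submodule.coe_add]
    abel
  · ext
    simp
  · ext
    simp [hlin, smul_sub]

/-- Keeps left projectivity along the whole resolution, so that every step splits over `Λ`. -/
theorem ker (hP : IsLeftProjective k Λ P) (hL : IsLeftProjective k Λ L)
    (f : P →ₗ[Λ ⊗[k] Λᵐᵒᵖ] L) (hf : Function.Surjective f) :
    IsLeftProjective k Λ (LinearMap.ker f) := by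
  obtain ⟨r, hr, hlin⟩ := hL.exists_retraction f hf
  let ι : Λ →+* Λ ⊗[k] Λᵐᵒᵖ := Algebra.TensorProduct.includeLeftRingHom
  exact @Module.Projective.of_split Λ _ (LinearMap.ker f) _ (Module.compHom _ ι) P _
    (Module.compHom P ι) hP
    (@LinearMap.mk _ _ _ _ _ _ _ _ _ (_) (_) (LinearMap.ker f).subtype.toAddHom fun a x => rfl)
    (@LinearMap.mk _ _ _ _ _ _ _ _ _ (_) (_) (r : P →ₙ+ LinearMap.ker f) fun a x => hlin a x)
    (@LinearMap.ext _ _ _ _ _ _ _ _ (_) (_) _ _ _ fun x => hr x)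

theorem of_projective [Module.Projective (Λ ⊗[k] Λᵐᵒᵖ) P] : IsLeftProjective k Λ P := by
  let _ : Module Λ P := Module.compHom P
    (Algebra.TensorProduct.includeLeftRingHom : Λ →+* Λ ⊗[k] Λᵐᵒᵖ)
  have : IsScalarTower Λ (Λ ⊗[k] Λᵐᵒᵖ) P := ⟨fun a b x => by
    change _ = (a ⊗ₜ[k] (1 : Λᵐᵒᵖ)) • b • x
    rw [smul_smul]
    congr 1
    induction b with
    | zero => simp
    | tmul c d => simp [TensorProduct.smul_tmul']
    | add b c hb hc => rw [smul_add, hb, hc, mul_add]⟩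
  obtain ⟨s, hs⟩ := Module.projective_def'.1 ‹Module.Projective (Λ ⊗[k] Λᵐᵒᵖ) P›
  have : Module.Free Λ (Λ ⊗[k] Λᵐᵒᵖ) :=
    .of_basis (Algebra.TensorProduct.basis Λ (Module.Free.chooseBasis k Λᵐᵒᵖ))
  exact Module.Projective.of_split (s.restrictScalars Λ)
    ((Finsupp.linearCombination (Λ ⊗[k] Λᵐᵒᵖ) id).restrictScalars Λ)
    (LinearMap.ext fun x => LinearMap.congr_fun hs x)

end IsLeftProjective

theorem BimoduleHom.precomp_subtype_surjective {k Λ} [Field k] [Ring Λ] [Algebra k Λ]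
    {P L N : Type*} [AddCommGroup P] [Module (Λ ⊗[k] Λᵐᵒᵖ) P] [AddCommGroup L]
    [Module (Λ ⊗[k] Λᵐᵒᵖ) L] [AddCommGroup N] [Module Λ N] (hL : IsLeftProjective k Λ L)
    (f : P →ₗ[Λ ⊗[k] Λᵐᵒᵖ] L) (hf : Function.Surjective f) :
    Function.Surjective (precomp (P := LinearMap.ker f) N (LinearMap.ker f).subtype) := by
  intro φ
  obtain ⟨r, hr, hlin⟩ := hL.exists_retraction f hf
  refine ⟨⟨φ.1.comp r, fun a x => ?_⟩, ext fun x => congrArg φ.1 (hr x)⟩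
  rw [AddMonoidHom.comp_apply, hlin, map_left]
  rfl

end Bimodule

/-! ### `Hom_Λ(P, N)` is projective for a projective bimodule `P` -/

section BimoduleHomProjective

variable {k : Type u} {Λ : Type v} [Field k] [Ring Λ] [Algebra k Λ] {t : Λ →ₗ[k] k}
  {N : Type*} [AddCommGroup N] [Module Λ N]

/-- The `N`-valued map on `Λ` with coordinates `t(· * y j)`. -/
noncomputable def coordMap {N : Type*} [AddCommGroup N] [Module k N] (t : Λ →ₗ[k] k) {d : ℕ}
    (e : Module.Basis (Fin d) k N) (y : Fin d → Λ) : Λ →ₗ[k] N :=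
  ∑ j, (t ∘ₗ LinearMap.mulRight k (y j)).smulRight (e j)

theorem coordMap_apply {N : Type*} [AddCommGroup N] [Module k N] (t : Λ →ₗ[k] k) {d : ℕ}
    (e : Module.Basis (Fin d) k N) (y : Fin d → Λ) (b : Λ) :
    coordMap t e y b = ∑ j, t (b * y j) • e j := by
  simp [coordMap]

section

variable [Module k N] [IsScalarTower k Λ N]

/-- The left linear extension `a ⊗ b ↦ a • ψ b` of a `k`-linear map `ψ`. -/
noncomputable def leftExtension (ψ : Λ →ₗ[k] N) : Λ ⊗[k] Λᵐᵒᵖ →ₗ[k] N :=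
  TensorProduct.lift ((LinearMap.lcomp k N (ψ ∘ₗ (MulOpposite.opLinearEquiv k).symm.toLinearMap)) ∘ₗ
    (Algebra.lsmul k k N).toLinearMap)

theorem leftExtension_tmul (ψ : Λ →ₗ[k] N) (a : Λ) (b : Λᵐᵒᵖ) :
    leftExtension ψ (a ⊗ₜ b) = a • ψ b.unop := rfl

theorem leftExtension_mul (ψ : Λ →ₗ[k] N) (a : Λ) (z : Λ ⊗[k] Λᵐᵒᵖ) :
    leftExtension ψ ((a ⊗ₜ[k] (1 : Λᵐᵒᵖ)) * z) = a • leftExtension ψ z := by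
  induction z with
  | zero => simp
  | tmul c d => simp [leftExtension_tmul, mul_smul]
  | add x y hx hy => rw [mul_add, map_add, hx, hy, map_add, smul_add]

/-- The comparison map between `Λ^{nd}` and the homomorphisms from `(Λ ⊗ Λᵒᵖ)ⁿ` to `N`. -/
noncomputable def freeComparison (t : Λ →ₗ[k] k) {d : ℕ} (e : Module.Basis (Fin d) k N) (n : ℕ) :
    (Fin n → Fin d → Λ) →ₗ[Λ] BimoduleHom k Λ (Fin n → Λ ⊗[k] Λᵐᵒᵖ) N where
  toFun y := ⟨∑ i, (leftExtension (coordMap t e (y i))).toAddMonoidHom.comp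
      (Pi.evalAddMonoidHom (fun _ : Fin n => Λ ⊗[k] Λᵐᵒᵖ) i), fun a z => by
    simp [leftExtension_mul, Finset.smul_sum]⟩
  map_add' y z := BimoduleHom.ext fun x => by
    simp only [BimoduleHom.add_apply, AddMonoidHom.finsetSum_apply, AddMonoidHom.comp_apply]
    rw [← Finset.sum_add_distrib]
    refine Finset.sum_congr rfl fun i _ => ?_
    have : coordMap t e ((y + z) i) = coordMap t e (y i) + coordMap t e (z i) :=
      LinearMap.ext fun b => by
        simp [coordMap_apply, mul_add, add_smul, Finset.sum_add_distrib]
    simp only [Pi.evalAddMonoidHom_apply, LinearMap.toAddMonoidHom_coe, this]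
    induction x i with
    | zero => simp
    | tmul a b => simp [leftExtension_tmul]
    | add x y hx hy => rw [map_add, hx, hy, map_add, map_add, add_add_add_comm]
  map_smul' c y := BimoduleHom.ext fun x => by
    simp only [BimoduleHom.smul_apply, AddMonoidHom.finsetSum_apply, AddMonoidHom.comp_apply,
      RingHom.id_apply]
    refine Finset.sum_congr rfl fun i _ => ?_
    simp only [Pi.evalAddMonoidHom_apply, Pi.smul_apply, LinearMap.toAddMonoidHom_coe, smul_eq_mul]
    induction x i with
    | zero => simp
    | tmul a b => simp [leftExtension_tmul, coordMap_apply, mul_assoc]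
    | add x y hx hy => rw [mul_add, map_add, hx, hy, map_add]

theorem freeComparison_single (t : Λ →ₗ[k] k) {d : ℕ} (e : Module.Basis (Fin d) k N) {n : ℕ}
    (y : Fin n → Fin d → Λ) (i : Fin n) (z : Λ ⊗[k] Λᵐᵒᵖ) :
    (freeComparison t e n y).1 (Pi.single i z) = leftExtension (coordMap t e (y i)) z := by
  simp only [freeComparison, LinearMap.coe_mk, AddHom.coe_mk, AddMonoidHom.finsetSum_apply,
    AddMonoidHom.comp_apply, Pi.evalAddMonoidHom_apply, LinearMap.toAddMonoidHom_coe]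
  rw [Finset.sum_eq_single i]
  · simp
  · intro j _ hj
    simp [hj]
  · simp

theorem IsSymmetrizingForm.freeComparison_bijective (ht : IsSymmetrizingForm t) {d : ℕ}
    (e : Module.Basis (Fin d) k N) (n : ℕ) : Function.Bijective (freeComparison t e n) := by
  constructor
  · rw [← LinearMap.ker_eq_bot, LinearMap.ker_eq_bot']
    intro y hy
    funext i j
    refine ht.nondegenerate _ fun b => ?_
    have h := freeComparison_single t e y i (1 ⊗ₜ MulOpposite.op b)
    rw [hy, leftExtension_tmul, one_smul, MulOpposite.unop_op, coordMap_apply] at h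
    exact Fintype.linearIndependent_iff.1 e.linearIndependent _ h.symm j
  · intro f
    -- By left linearity `f` is determined by its values on `1 ⊗ b` in each slot; the form
    -- represents the coordinates of these `k`-linear maps.
    have hψ : ∀ i : Fin n, ∃ ψ : Λ →ₗ[k] N, ∀ b,
        ψ b = f.1 (Pi.single i ((1 : Λ) ⊗ₜ[k] MulOpposite.op b)) := fun i =>
      ⟨⟨⟨fun b => f.1 (Pi.single i ((1 : Λ) ⊗ₜ[k] MulOpposite.op b)), fun b c => by
        rw [MulOpposite.op_add, TensorProduct.tmul_add, Pi.single_add, map_add]⟩, fun c b => by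
        change f.1 _ = c • f.1 _
        rw [← algebraMap_smul Λ c (f.1 _), ← BimoduleHom.map_left, ← Pi.single_smul]
        rw [smul_eq_mul, Algebra.TensorProduct.tmul_mul_tmul, one_mul, mul_one,
          Algebra.algebraMap_eq_smul_one, TensorProduct.smul_tmul, MulOpposite.op_smul]⟩,
        fun b => rfl⟩
    choose ψ hψ using hψ
    choose y hy using fun (i : Fin n) (j : Fin d) => ht.represents (e.coord j ∘ₗ ψ i)
    refine ⟨y, Subtype.ext (AddMonoidHom.functions_ext _ _ _ fun i z => ?_)⟩
    rw [freeComparison_single]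
    induction z with
    | zero => simp
    | tmul a b =>
      have h1 : coordMap t e (y i) b.unop = ψ i b.unop := by
        rw [coordMap_apply]
        conv_rhs => rw [← e.sum_repr (ψ i b.unop)]
        exact Finset.sum_congr rfl fun j _ => by rw [hy]; rfl
      rw [leftExtension_tmul, h1, hψ, ← BimoduleHom.map_left, ← Pi.single_smul]
      simp
    | add x y hx hy => rw [map_add, hx, hy, Pi.single_add, map_add]

end

variable {P : Type*} [AddCommGroup P] [Module (Λ ⊗[k] Λᵐᵒᵖ) P]

theorem IsSymmetrizingForm.finite_projective_bimoduleHom (ht : IsSymmetrizingForm t)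
    [FiniteDimensional k Λ] [Module.Finite Λ N] [Module.Finite (Λ ⊗[k] Λᵐᵒᵖ) P]
    [Module.Projective (Λ ⊗[k] Λᵐᵒᵖ) P] : Module.Finite Λ (BimoduleHom k Λ P N) ∧
      Module.Projective Λ (BimoduleHom k Λ P N) := by
  let _ : Module k N := Module.compHom N (algebraMap k Λ)
  have : IsScalarTower k Λ N := ⟨fun a b x => by rw [Algebra.smul_def, mul_smul]; rfl⟩
  have : Module.Finite k N := Module.Finite.trans Λ N
  obtain ⟨n, r, s, -, -, hrs⟩ := Module.Finite.exists_comp_eq_id_of_projective (Λ ⊗[k] Λᵐᵒᵖ) P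
  let E := LinearEquiv.ofBijective _
    (ht.freeComparison_bijective (Module.finBasis k N) n)
  have hsplit : (BimoduleHom.precomp N s ∘ₗ E.toLinearMap) ∘ₗ
      (E.symm.toLinearMap ∘ₗ BimoduleHom.precomp N r) = LinearMap.id := by
    refine LinearMap.ext fun f => BimoduleHom.ext fun x => ?_
    simp only [LinearMap.comp_apply, LinearEquiv.coe_coe, LinearEquiv.apply_symm_apply,
      BimoduleHom.precomp_apply, LinearMap.id_apply]
    exact congrArg f.1 (LinearMap.congr_fun hrs x)
  exact ⟨Module.Finite.of_surjective (BimoduleHom.precomp N s ∘ₗ E.toLinearMap)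
      fun f => ⟨_, LinearMap.congr_fun hsplit f⟩,
    Module.Projective.of_split _ _ hsplit⟩

end BimoduleHomProjective

/-! ### From the bimodule resolution to cosyzygies of modules -/

section Periodic

variable {k : Type u} {Λ : Type v} [Field k] [Ring Λ] [Algebra k Λ] {t : Λ →ₗ[k] k}

/-- Lift a finite free cover of `M` to `P`: its image and the superfluous kernel of `f` span `P`, so
the image is everything. This is where minimality of the resolution enters. -/
theorem IsProjectiveCover.finite {R : Type u} [Ring R] {P M : Type v} [AddCommGroup P]
    [Module R P] [AddCommGroup M] [Module R M] [Module.Finite R M] {f : P →ₗ[R] M}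
    (hf : IsProjectiveCover f) : Module.Finite R P := by
  obtain ⟨n, g, hg⟩ := Module.Finite.exists_fin' R M
  obtain ⟨g', hg'⟩ := Module.projective_lifting_property f g hf.surjective
  refine Module.Finite.of_surjective g' (LinearMap.range_eq_top.1 (hf.superfluous _ ?_))
  refine eq_top_iff.2 fun x _ => ?_
  obtain ⟨y, hy⟩ := hg (f x)
  refine Submodule.mem_sup.2 ⟨g' y, ⟨y, rfl⟩, x - g' y, ?_, add_sub_cancel _ _⟩
  rw [LinearMap.mem_ker, map_sub, ← hy, ← hg', LinearMap.comp_apply, sub_self]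

theorem IsSymmetrizingForm.isCosyzygy_bimoduleHom (ht : IsSymmetrizingForm t)
    [FiniteDimensional k Λ] (N : Type v) [AddCommGroup N] [Module Λ N] [Module.Finite Λ N]
    {P L : Type v} [AddCommGroup P] [Module (Λ ⊗[k] Λᵐᵒᵖ) P] [AddCommGroup L]
    [Module (Λ ⊗[k] Λᵐᵒᵖ) L] [Module.Finite (Λ ⊗[k] Λᵐᵒᵖ) L] (hL : IsLeftProjective k Λ L)
    {f : P →ₗ[Λ ⊗[k] Λᵐᵒᵖ] L} (hf : IsProjectiveCover f) :
    IsCosyzygy (ModuleCat.of Λ (BimoduleHom k Λ L N))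
      (ModuleCat.of Λ (BimoduleHom k Λ (LinearMap.ker f) N)) := by
  have := hf.projective
  have := hf.finite
  obtain ⟨_, _⟩ := ht.finite_projective_bimoduleHom (N := N) (P := P)
  exact .of_exact _ _ (BimoduleHom.precomp_injective f hf.surjective)
    (BimoduleHom.precomp_exact f hf.surjective)
    (BimoduleHom.precomp_subtype_surjective hL f hf.surjective)

/-- An isomorphism of bimodules induces an isomorphism on homomorphisms. -/
def BimoduleHom.congrIso (N : Type v) [AddCommGroup N] [Module Λ N]
    {L L' : ModuleCat.{v} (Λ ⊗[k] Λᵐᵒᵖ)} (e : L ≅ L') :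
    ModuleCat.of Λ (BimoduleHom k Λ L N) ≅ ModuleCat.of Λ (BimoduleHom k Λ L' N) where
  hom := ModuleCat.ofHom (precomp N e.inv.hom)
  inv := ModuleCat.ofHom (precomp N e.hom.hom)
  hom_inv_id := ModuleCat.hom_ext <| LinearMap.ext fun f => BimoduleHom.ext fun x =>
    congrArg f.1 (e.hom_inv_id_apply x)
  inv_hom_id := ModuleCat.hom_ext <| LinearMap.ext fun f => BimoduleHom.ext fun x =>
    congrArg f.1 (e.inv_hom_id_apply x)

theorem IsSymmetrizingForm.transGen_isCosyzygy_bimoduleHom (ht : IsSymmetrizingForm t)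
    [FiniteDimensional k Λ] (N : Type v) [AddCommGroup N] [Module Λ N] [Module.Finite Λ N]
    (n : ℕ) (L X : ModuleCat.{v} (Λ ⊗[k] Λᵐᵒᵖ)) (hfin : Module.Finite (Λ ⊗[k] Λᵐᵒᵖ) L)
    (hL : IsLeftProjective k Λ L) (h : IsMinimalSyzygy (n + 1) L X) :
    Relation.TransGen IsCosyzygy (ModuleCat.of Λ (BimoduleHom k Λ L N))
      (ModuleCat.of Λ (BimoduleHom k Λ X N)) := by
  induction n generalizing L with
  | zero =>
    obtain ⟨P, f, hf, ⟨e⟩⟩ := h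
    exact .single ((ht.isCosyzygy_bimoduleHom N hL hf).congr_right
      (BimoduleHom.congrIso N e.symm))
  | succ n ih =>
    obtain ⟨P, f, hf, hker⟩ := h
    have := hf.projective
    have := hf.finite
    -- Needed for the next syzygy to be finitely generated again.
    have : IsNoetherianRing (Λ ⊗[k] Λᵐᵒᵖ) := IsNoetherianRing.of_finite k _
    refine .head (ht.isCosyzygy_bimoduleHom N hL hf) (ih _ ?_ ?_ hker)
    · exact inferInstanceAs (Module.Finite _ (LinearMap.ker f))
    · exact IsLeftProjective.of_projective.ker hL f hf.surjective

end Periodic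

/-! ### The regular bimodule and the loop through `N` -/

section Regular

variable (k : Type u) (Λ : Type v) [Field k] [Ring Λ] [Algebra k Λ]

/-- The identity map from `Λ` to its regular bimodule. -/
def toRegularBimodule : Λ ≃+ regularBimodule k Λ := AddEquiv.refl Λ

theorem tmul_smul_toRegularBimodule (a b x : Λ) :
    (a ⊗ₜ[k] MulOpposite.op b) • toRegularBimodule k Λ x = toRegularBimodule k Λ (a * (x * b)) :=
  rfl

theorem isLeftProjective_regularBimodule : IsLeftProjective k Λ (regularBimodule k Λ) := by
  let _ : Module Λ (regularBimodule k Λ) := Module.compHom _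
    (Algebra.TensorProduct.includeLeftRingHom : Λ →+* Λ ⊗[k] Λᵐᵒᵖ)
  let E : Λ ≃ₗ[Λ] regularBimodule k Λ :=
    { toRegularBimodule k Λ with
      map_smul' := fun a x => by
        have := tmul_smul_toRegularBimodule k Λ a 1 x
        rw [mul_one] at this
        exact this.symm }
  exact Module.Projective.of_equiv E

instance finite_regularBimodule : Module.Finite (Λ ⊗[k] Λᵐᵒᵖ) (regularBimodule k Λ) :=
  Module.Finite.of_surjective
    (LinearMap.toSpanSingleton (Λ ⊗[k] Λᵐᵒᵖ) _ (toRegularBimodule k Λ 1)) fun x => by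
      obtain ⟨x, rfl⟩ := (toRegularBimodule k Λ).surjective x
      refine ⟨x ⊗ₜ MulOpposite.op 1, ?_⟩
      rw [LinearMap.toSpanSingleton_apply, tmul_smul_toRegularBimodule, mul_one, mul_one]

variable {Λ} in
/-- Evaluation at `1`. -/
def regularBimoduleHomEquiv (N : Type v) [AddCommGroup N] [Module Λ N] :
    BimoduleHom k Λ (regularBimodule k Λ) N ≃ₗ[Λ] N where
  toFun f := f.1 (toRegularBimodule k Λ 1)
  map_add' _ _ := rfl
  map_smul' b f := by
    rw [BimoduleHom.smul_apply, RingHom.id_apply, ← BimoduleHom.map_left, ← MulOpposite.op_one,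
      tmul_smul_toRegularBimodule, tmul_smul_toRegularBimodule]
    simp
  invFun x := ⟨(LinearMap.toSpanSingleton Λ N x).toAddMonoidHom.comp
    (toRegularBimodule k Λ).symm.toAddMonoidHom, fun a y => by
      obtain ⟨y, rfl⟩ := (toRegularBimodule k Λ).surjective y
      rw [← MulOpposite.op_one, tmul_smul_toRegularBimodule]
      simp [mul_smul]⟩
  left_inv f := BimoduleHom.ext fun y => by
    obtain ⟨y, rfl⟩ := (toRegularBimodule k Λ).surjective y
    simp only [AddMonoidHom.comp_apply, LinearMap.toAddMonoidHom_coe,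
      LinearMap.toSpanSingleton_apply, AddEquiv.toAddMonoidHom_eq_coe, AddMonoidHom.coe_coe,
      AddEquiv.symm_apply_apply]
    rw [← BimoduleHom.map_left, ← MulOpposite.op_one, tmul_smul_toRegularBimodule]
    simp
  right_inv x := by simp

variable {k} {Λ}

/-- Every finitely generated module over a periodic symmetric algebra occurs in its own sequence
of cosyzygies. -/
theorem IsPeriodicAlgebra.transGen_isCosyzygy [FiniteDimensional k Λ]
    (hper : IsPeriodicAlgebra k Λ) {t : Λ →ₗ[k] k} (ht : IsSymmetrizingForm t)
    (N : ModuleCat.{v} Λ) [Module.Finite Λ N] : Relation.TransGen IsCosyzygy N N := by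
  obtain ⟨p, hp, h⟩ := hper
  obtain ⟨n, rfl⟩ := Nat.exists_eq_add_of_le' hp
  have key := ht.transGen_isCosyzygy_bimoduleHom N n _ _ (finite_regularBimodule k Λ)
    (isLeftProjective_regularBimodule k Λ) h
  let e : ModuleCat.of Λ (BimoduleHom k Λ (regularBimodule k Λ) N) ≅ N :=
    (regularBimoduleHomEquiv k N).toModuleIso
  -- The chain joins `Hom_Λ(Λ, N)` to itself; its first and last links are transported separately
  -- along the isomorphism with `N`.
  obtain ⟨X, h1, h2⟩ := Relation.TransGen.head'_iff.1 key
  have key' : Relation.TransGen IsCosyzygy N _ := .head' (h1.congr_left e) h2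
  obtain ⟨Y, h3, h4⟩ := Relation.TransGen.tail'_iff.1 key'
  exact .tail' h3 (h4.congr_right e)

end Regular

theorem mainTheorem2 (k : Type u) (Λ : Type v) [Field k] [Ring Λ] [Algebra k Λ]
    [FiniteDimensional k Λ]
    (hsymm : IsSymmAlgebra k Λ) (hper : IsPeriodicAlgebra k Λ)
    (hss : IsSemisimpleRing ((Λ ⧸ Ring.jacobson Λ) ⊗[k] (Λ ⧸ Ring.jacobson Λ)))
    (M N : ModuleCat.{v} Λ) [Module.Finite Λ M] [Module.Finite Λ N] :
    List.TFAE [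
      ∃ n : ℕ, ∀ i : ℕ, n ≤ i → Subsingleton (Abelian.Ext M N i),
      ∀ i : ℕ, 0 < i → Subsingleton (Abelian.Ext M N i),
      ∃ n : ℕ, ∀ i : ℕ, n ≤ i → Subsingleton (Abelian.Ext N M i),
      ∀ i : ℕ, 0 < i → Subsingleton (Abelian.Ext N M i)] := by
  obtain ⟨t, ht⟩ := hsymm.exists_symmetrizingForm
  have hM := hper.transGen_isCosyzygy ht M
  have hN := hper.transGen_isCosyzygy ht N
  tfae_have 1 → 2 := fun ⟨_, h⟩ => ht.extVanishesFrom_one hN h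
  tfae_have 2 → 4 := fun h => ht.extVanishesFrom_one_symm hN h
  tfae_have 4 → 3 := fun h => ⟨1, h⟩
  tfae_have 3 → 4 := fun ⟨_, h⟩ => ht.extVanishesFrom_one hM h
  tfae_have 4 → 2 := fun h => ht.extVanishesFrom_one_symm hM h
  tfae_have 2 → 1 := fun h => ⟨1, h⟩
  tfae_finish
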